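/- Let $d\ge 2$, $1\le q,\tilde q<\infty$, $2\le r,\tilde r\le\infty$ and $1\le p<\infty$, and let $\tilde q',\tilde r'$ denote the conjugate exponents of $\tilde q,\tilde r$. Write $L^{q,p}_tL^r_x$ for the space with (quasi-)norm obtained by taking the Lorentz $L^{q,p}(\mathbb{R})$ norm of $t\mapsto\|u(t,\cdot)\|_{L^r(\mathbb{R}^d)}$, where $$\|g\|_{L^{q,p}(\mathbb{R})}=\Big(p\int_0^\infty a^{p-1}\,\big|\{t\in\mathbb{R}: |g(t)|>a\}\big|^{p/q}\,da\Big)^{1/p},$$ and let $e^{it\sqrt{-\Delta}}$ denote the half-wave propagator on $\mathbb{R}^d$ (the Fourier multiplier with symbol $e^{it|\xi|}$). Suppose that for every compact set $K\subset\mathbb{R}^d\setminus\{0\}$ there is a constant $C<\infty$ such that $$\Big\|\int_{\mathbb{R}} e^{i(t-s)\sqrt{-\Delta}}F(s,\cdot)\,ds\Big\|_{L^{q,p}_tL^r_x}\le C\,\|F\|_{L^{\tilde q'}_tL^{\tilde r'}_x}$$ for all Schwartz functions $F:\mathbb{R}\times\mathbb{R}^d\to\mathbb{C}$ such that, for every $t\in\mathbb{R}$,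 the spatial Fourier transform of $F(t,\cdot)$ is supported in $K$. (This is the case in particular if the estimate holds with one constant $C$ for all such $F$ and all $K$.) Then $$\frac1q<(d-1)\Big(\frac12-\frac1r\Big).$$ -/

import Mathlib

open MeasureTheory Set
open scoped ENNReal NNReal FourierTransform SchwartzMap

noncomputable section

/-- The half-wave propagator `e^{i t √(-Δ)}` applied to `f`. With the normalisation
`𝓕 f ξ = ∫ e^{-2πi⟨x, ξ⟩} f x dx` of the Fourier transform, `√(-Δ)` is the Fourier multiplier with
symbol `2π|ξ|`. -/
def halfWave {d : ℕ} (t : ℝ) (f : EuclideanSpace ℝ (Fin d) → ℂ) : EuclideanSpace ℝ (Fin d) → ℂ :=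
  𝓕⁻ (fun ξ : EuclideanSpace ℝ (Fin d) =>
    Complex.exp (Complex.I * ((t * (2 * Real.pi * ‖ξ‖) : ℝ) : ℂ)) * 𝓕 f ξ)

/-- The operator `F ↦ ∫_ℝ e^{i(t-s)√(-Δ)} F(s, ·) ds`, evaluated at `(t, x)`. -/
def waveDuhamel {d : ℕ} (F : ℝ × EuclideanSpace ℝ (Fin d) → ℂ) (t : ℝ)
    (x : EuclideanSpace ℝ (Fin d)) : ℂ :=
  ∫ s : ℝ, halfWave (t - s) (fun y => F (s, y)) x

/-- The Lorentz `L^{q,p}` (quasi-)norm, `0 < q, p < ∞`, of a nonnegative function `g`, through its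
distribution function: `(p ∫_0^∞ a^{p-1} μ{g > a}^{p/q} da)^{1/p}`. For `p = q` it is the
`L^q` norm. -/
def lorentzNorm {α : Type*} [MeasurableSpace α] (g : α → ℝ≥0∞) (q p : ℝ) (μ : Measure α) : ℝ≥0∞ :=
  (ENNReal.ofReal p * ∫⁻ a in Ioi (0 : ℝ),
    ENNReal.ofReal (a ^ (p - 1)) * μ {y | ENNReal.ofReal a < g y} ^ (p / q)) ^ (1 / p)

/-- The mixed norm of `u` in `L^{q,p}_t L^r_x`. -/
def lorentzMixedNorm {d : ℕ} (u : ℝ → EuclideanSpace ℝ (Fin d) → ℂ) (q p : ℝ) (r : ℝ≥0∞) : ℝ≥0∞ :=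
  lorentzNorm (fun t => eLpNorm (u t) r volume) q p volume

/-- The mixed norm of `u` in `L^q_t L^r_x`. -/
def mixedNorm {d : ℕ} (u : ℝ → EuclideanSpace ℝ (Fin d) → ℂ) (q r : ℝ≥0∞) : ℝ≥0∞ :=
  eLpNorm (fun t => eLpNorm (u t) r volume) q volume

/-- The spatial Fourier transform of `F` is supported in `ℝ × K`. -/
def SpatialFourierSupportIn {d : ℕ} (F : ℝ × EuclideanSpace ℝ (Fin d) → ℂ)
    (K : Set (EuclideanSpace ℝ (Fin d))) : Prop :=
  ∀ t : ℝ, tsupport (𝓕 (fun x => F (t, x))) ⊆ K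

end

/-! The right side of the estimate sees only the input, while the output may be a free wave for all
time. Take `F = ψ ⊗ 𝓕⁻ χ` with `χ` a bump away from the origin and `𝓕 ψ = 1` at every `|ξ|`, `ξ` in
the support of `χ`. Integrating in `s` replaces `e^{-is√(-Δ)}` by the multiplier `𝓕 ψ(|ξ|) = 1`, so
the output is exactly `e^{it√(-Δ)} 𝓕⁻ χ` (`waveDuhamel_tensorMul`).

This wave has constant `L²` mass, and half of it stays in a shell of fixed width around `|x| = t`.
That needs no stationary phase: by Plancherel the weight `|x|² - t²` becomes a multiple of `Δ_ξ +
4π²t²` acting on `e^{2πit|ξ|} χ`, where the `t²` terms cancel because `|∇|ξ|| = 1`. Hence the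
weighted `L²` norm is `O(t)` (`exists_moment_bound`), and Chebyshev applies. The shell has volume
`O(t^{d-1})`, so Hölder bounds the `L^r` norm below by a multiple of `t^{-(d-1)(1/2-1/r)}`
(`exists_eLpNorm_ge_of_moment_bound`).

If the conclusion fails, this decays no faster than `t^{-1/q}`, which at infinity lies in weak `L^q`
but in no `L^{q,p}` with `p < ∞` (`lorentzNorm_eq_top_of_rpow_le`). This is why equality is excluded
too. -/

/-- The tensor product of two Schwartz functions. -/
noncomputable def SchwartzMap.tensorMul {D E : Type*} [NormedAddCommGroup D] [NormedSpace ℝ D]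
    [NormedAddCommGroup E] [NormedSpace ℝ E] (f : 𝓢(D, ℂ)) (g : 𝓢(E, ℂ)) : 𝓢(D × E, ℂ) where
  toFun z := f z.1 * g z.2
  smooth' := (f.smooth'.comp contDiff_fst).mul (g.smooth'.comp contDiff_snd)
  decay' k n := by
    have hfst : ∀ (i : ℕ) (z : D × E),
        ‖iteratedFDeriv ℝ i (fun z : D × E => f z.1) z‖ ≤ ‖iteratedFDeriv ℝ i f z.1‖ := by
      intro i z
      have := (ContinuousLinearMap.fst ℝ D E).iteratedFDeriv_comp_right (f.smooth i) z
        (i := i) le_rfl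
      change ‖iteratedFDeriv ℝ i (f ∘ ContinuousLinearMap.fst ℝ D E) z‖ ≤ _
      rw [this]
      refine (ContinuousMultilinearMap.norm_compContinuousLinearMap_le _ _).trans ?_
      refine mul_le_of_le_one_right (norm_nonneg _) (Finset.prod_le_one (fun _ _ => norm_nonneg _)
        (fun _ _ => ContinuousLinearMap.norm_fst_le ..))
    have hsnd : ∀ (i : ℕ) (z : D × E),
        ‖iteratedFDeriv ℝ i (fun z : D × E => g z.2) z‖ ≤ ‖iteratedFDeriv ℝ i g z.2‖ := by
      intro i z
      have := (ContinuousLinearMap.snd ℝ D E).iteratedFDeriv_comp_right (g.smooth i) z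
        (i := i) le_rfl
      change ‖iteratedFDeriv ℝ i (g ∘ ContinuousLinearMap.snd ℝ D E) z‖ ≤ _
      rw [this]
      refine (ContinuousMultilinearMap.norm_compContinuousLinearMap_le _ _).trans ?_
      refine mul_le_of_le_one_right (norm_nonneg _) (Finset.prod_le_one (fun _ _ => norm_nonneg _)
        (fun _ _ => ContinuousLinearMap.norm_snd_le ..))
    have hf : ∀ k n, ∃ C, ∀ x, ‖x‖ ^ k * ‖iteratedFDeriv ℝ n f x‖ ≤ C := f.decay'
    have hg : ∀ k n, ∃ C, ∀ x, ‖x‖ ^ k * ‖iteratedFDeriv ℝ n g x‖ ≤ C := g.decay'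
    choose A hA using hf
    choose B hB using hg
    have hA0 : ∀ i x, ‖iteratedFDeriv ℝ i f x‖ ≤ A 0 i := fun i x => by simpa using hA 0 i x
    have hB0 : ∀ i x, ‖iteratedFDeriv ℝ i g x‖ ≤ B 0 i := fun i x => by simpa using hB 0 i x
    refine ⟨∑ i ∈ Finset.range (n + 1), (n.choose i : ℝ) *
      (A k i * B 0 (n - i) + A 0 i * B k (n - i)), fun z => ?_⟩
    have hz : ‖z‖ ^ k ≤ ‖z.1‖ ^ k + ‖z.2‖ ^ k := by
      rcases le_total ‖z.1‖ ‖z.2‖ with h | h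
      · rw [Prod.norm_def, max_eq_right h]
        exact le_add_of_nonneg_left (by positivity)
      · rw [Prod.norm_def, max_eq_left h]
        exact le_add_of_nonneg_right (by positivity)
    have hmul := norm_iteratedFDeriv_mul_le (𝕜 := ℝ) (N := n)
      ((f.smooth n).comp (contDiff_fst (F := E))) ((g.smooth n).comp (contDiff_snd (E := D)))
      z (n := n) le_rfl
    refine (mul_le_mul hz hmul (norm_nonneg _) (by positivity)).trans ?_
    rw [Finset.mul_sum]
    refine Finset.sum_le_sum fun i _ => ?_
    have h1 := mul_le_mul (hA k i z.1) (hB0 (n - i) z.2) (norm_nonneg _)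
      ((by positivity : (0:ℝ) ≤ _).trans (hA k i z.1))
    have h2 := mul_le_mul (hA0 i z.1) (hB k (n - i) z.2) (by positivity)
      ((norm_nonneg _).trans (hA0 i z.1))
    have h3 := mul_le_mul (hfst i z) (hsnd (n - i) z) (norm_nonneg _) (norm_nonneg _)
    calc (‖z.1‖ ^ k + ‖z.2‖ ^ k) * ((n.choose i : ℝ) *
          ‖iteratedFDeriv ℝ i (fun z : D × E => f z.1) z‖ *
          ‖iteratedFDeriv ℝ (n - i) (fun z : D × E => g z.2) z‖)
        = (n.choose i : ℝ) * ((‖z.1‖ ^ k + ‖z.2‖ ^ k) *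
          (‖iteratedFDeriv ℝ i (fun z : D × E => f z.1) z‖ *
          ‖iteratedFDeriv ℝ (n - i) (fun z : D × E => g z.2) z‖)) := by ring
      _ ≤ (n.choose i : ℝ) * ((‖z.1‖ ^ k + ‖z.2‖ ^ k) *
          (‖iteratedFDeriv ℝ i f z.1‖ * ‖iteratedFDeriv ℝ (n - i) g z.2‖)) := by gcongr
      _ ≤ _ := by
        refine mul_le_mul_of_nonneg_left ?_ (by positivity)
        linarith

@[simp]
theorem SchwartzMap.tensorMul_apply {D E : Type*} [NormedAddCommGroup D] [NormedSpace ℝ D]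
    [NormedAddCommGroup E] [NormedSpace ℝ E] (f : 𝓢(D, ℂ)) (g : 𝓢(E, ℂ)) (z : D × E) :
    f.tensorMul g z = f z.1 * g z.2 := rfl

/-! ### Divergence of Lorentz norms for slowly decaying functions -/

theorem lintegral_ofReal_inv_Ioo_eq_top {b : ℝ} (hb : 0 < b) :
    ∫⁻ a in Ioo 0 b, ENNReal.ofReal a⁻¹ = ∞ := by
  by_contra h
  have hint : IntegrableOn (fun a : ℝ => a⁻¹) (Ioo 0 b) := by
    refine ⟨(measurable_inv).aestronglyMeasurable, ?_⟩
    rw [hasFiniteIntegral_iff_ofReal]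
    · exact lt_top_iff_ne_top.2 h
    · filter_upwards [self_mem_ae_restrict measurableSet_Ioo] with a ha
      exact inv_nonneg.2 ha.1.le
  have := (intervalIntegrable_iff_integrableOn_Ioo_of_le hb.le).2 hint
  rw [intervalIntegrable_inv_iff] at this
  rcases this with h | h
  · exact hb.ne h
  · exact h (by simp [hb.le])

/-- For small `a` the level set `{g > a}` has measure at least a multiple of `a^{-q}`, so the
integrand dominates a multiple of `a^{p-1} a^{-p} = 1/a`. -/
theorem lorentzNorm_eq_top_of_rpow_le {g : ℝ → ℝ≥0∞} {q p c T : ℝ} (hq : 0 < q) (hp : 0 < p)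
    (hc : 0 < c) (hT : 0 < T) (hg : ∀ t, T ≤ t → ENNReal.ofReal (c * t ^ (-(1 / q))) ≤ g t) :
    lorentzNorm g q p volume = ∞ := by
  have hpq : 0 < p / q := by positivity
  -- For `a < b` one has `(c/a)^q ≥ 2T`, so discarding times before `T` loses at most half of the
  -- level set's length.
  set b : ℝ := c * (2 * T) ^ (-(1 / q)) with hb
  have hbpos : 0 < b := by positivity
  have hmeas : ∀ a ∈ Ioo 0 b, ENNReal.ofReal ((c / a) ^ q / 2) ≤
      volume {y | ENNReal.ofReal a < g y} := by
    intro a ha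
    have ha0 : 0 < a := ha.1
    have h2T : 2 * T ≤ (c / a) ^ q := by
      have h1 : (2 * T) ^ (1 / q) ≤ c / a := by
        rw [le_div_iff₀ ha0]
        have := ha.2.le
        rw [hb, Real.rpow_neg (by positivity), ← div_eq_mul_inv, le_div_iff₀ (by positivity)] at this
        linarith
      calc 2 * T = ((2 * T) ^ (1 / q)) ^ q := by
            rw [← Real.rpow_mul (by positivity), one_div_mul_cancel hq.ne', Real.rpow_one]
        _ ≤ _ := Real.rpow_le_rpow (by positivity) h1 hq.le
    have hsub : Ico T ((c / a) ^ q) ⊆ {y | ENNReal.ofReal a < g y} := by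
      intro t ht
      have ht0 : 0 < t := hT.trans_le ht.1
      refine lt_of_lt_of_le ?_ (hg t ht.1)
      rw [ENNReal.ofReal_lt_ofReal_iff (by positivity), Real.rpow_neg ht0.le, ← div_eq_mul_inv,
        lt_div_iff₀ (by positivity)]
      have : t ^ (1 / q) < c / a := by
        calc t ^ (1 / q) < ((c / a) ^ q) ^ (1 / q) :=
              Real.rpow_lt_rpow ht0.le ht.2 (by positivity)
          _ = c / a := by
            rw [← Real.rpow_mul (by positivity), mul_one_div_cancel hq.ne', Real.rpow_one]
      rw [lt_div_iff₀ ha0] at this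
      linarith
    refine le_trans ?_ (measure_mono hsub)
    rw [Real.volume_Ico]
    exact ENNReal.ofReal_le_ofReal (by linarith)
  have hint : ∫⁻ a in Ioi (0 : ℝ), ENNReal.ofReal (a ^ (p - 1)) *
      volume {y | ENNReal.ofReal a < g y} ^ (p / q) = ∞ := by
    rw [eq_top_iff]
    calc (∞ : ℝ≥0∞) = ENNReal.ofReal (c ^ p / 2 ^ (p / q)) *
          ∫⁻ a in Ioo 0 b, ENNReal.ofReal a⁻¹ := by
          rw [lintegral_ofReal_inv_Ioo_eq_top hbpos, ENNReal.mul_top]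
          simpa using (by positivity : 0 < c ^ p / 2 ^ (p / q))
      _ = ∫⁻ a in Ioo 0 b, ENNReal.ofReal (c ^ p / 2 ^ (p / q)) * ENNReal.ofReal a⁻¹ := by
          rw [lintegral_const_mul' _ _ ENNReal.ofReal_ne_top]
      _ ≤ ∫⁻ a in Ioo 0 b, ENNReal.ofReal (a ^ (p - 1)) *
          volume {y | ENNReal.ofReal a < g y} ^ (p / q) := by
          refine setLIntegral_mono' measurableSet_Ioo fun a ha => ?_
          have ha0 : 0 < a := ha.1
          refine le_trans (le_of_eq ?_)
            (mul_le_mul_right (ENNReal.rpow_le_rpow (hmeas a ha) hpq.le) _)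
          rw [ENNReal.ofReal_rpow_of_nonneg (by positivity) hpq.le,
            ← ENNReal.ofReal_mul (by positivity), ← ENNReal.ofReal_mul (by positivity)]
          congr 1
          rw [Real.div_rpow (by positivity) (by positivity), ← Real.rpow_mul (by positivity),
            mul_div_cancel₀ _ hq.ne', Real.div_rpow hc.le ha0.le, Real.rpow_sub_one ha0.ne']
          have := (Real.rpow_pos_of_pos ha0 p).ne'
          field_simp
      _ ≤ _ := lintegral_mono_set fun a ha => ha.1
  rw [lorentzNorm, hint, ENNReal.mul_top (by simpa using hp), ENNReal.top_rpow_of_pos (by positivity)]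

/-! ### Calculus of the wave phase on frequency data away from the origin -/

section

open scoped ContDiff LineDeriv

variable {d : ℕ}

/-- Compactly supported away from the origin. -/
structure SupportedOffZero (a : EuclideanSpace ℝ (Fin d) → ℂ) : Prop where
  compact : HasCompactSupport a
  zero_notMem : 0 ∉ tsupport a

open Classical in
/-- The product `m a` as a Schwartz function, for `a` compactly supported and `m a` smooth. -/
noncomputable def mulSchwartz (m : EuclideanSpace ℝ (Fin d) → ℂ)
    (a : 𝓢(EuclideanSpace ℝ (Fin d), ℂ)) : 𝓢(EuclideanSpace ℝ (Fin d), ℂ) :=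
  -- The fallback `0` is never reached when `m` is smooth off the origin and `a` is
  -- `SupportedOffZero`.
  if h : HasCompactSupport (fun x => m x * a x) ∧ ContDiff ℝ ∞ (fun x => m x * a x) then
    h.1.toSchwartzMap h.2 else 0

theorem mulSchwartz_apply {m : EuclideanSpace ℝ (Fin d) → ℂ}
    {a : 𝓢(EuclideanSpace ℝ (Fin d), ℂ)} (hm : ∀ x ≠ 0, ContDiffAt ℝ ∞ m x)
    (ha : SupportedOffZero a) (x : EuclideanSpace ℝ (Fin d)) :
    mulSchwartz m a x = m x * a x := by
  have h1 : HasCompactSupport (fun x => m x * a x) := ha.compact.mul_left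
  have h2 : ContDiff ℝ ∞ (fun x => m x * a x) := by
    rw [contDiff_iff_contDiffAt]
    intro x
    by_cases hx : x = 0
    · have h0 : a =ᶠ[nhds x] 0 := notMem_tsupport_iff_eventuallyEq.1 (hx ▸ ha.zero_notMem)
      refine (contDiffAt_const (c := (0 : ℂ))).congr_of_eventuallyEq ?_
      filter_upwards [h0] with y hy
      simp [hy]
    · exact (hm x hx).mul (a.smooth ⊤).contDiffAt
  rw [mulSchwartz, dif_pos ⟨h1, h2⟩]
  rfl

theorem SupportedOffZero.mulSchwartz {m : EuclideanSpace ℝ (Fin d) → ℂ}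
    {a : 𝓢(EuclideanSpace ℝ (Fin d), ℂ)} (hm : ∀ x ≠ 0, ContDiffAt ℝ ∞ m x)
    (ha : SupportedOffZero a) : SupportedOffZero (mulSchwartz m a) := by
  have hfun : ⇑(_root_.mulSchwartz m a) = fun x => m x * a x :=
    funext (mulSchwartz_apply hm ha)
  rw [hfun]
  exact ⟨ha.compact.mul_left, fun h => ha.zero_notMem (tsupport_mul_subset_right h)⟩

theorem SupportedOffZero.lineDerivOp {a : 𝓢(EuclideanSpace ℝ (Fin d), ℂ)}
    (ha : SupportedOffZero a) (v : EuclideanSpace ℝ (Fin d)) : SupportedOffZero ⇑(∂_{v} a : 𝓢(EuclideanSpace ℝ (Fin d), ℂ)) :=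
  ⟨ha.compact.mono' ((subset_tsupport _).trans (SchwartzMap.tsupport_lineDerivOp_subset v a)),
    fun h => ha.zero_notMem (SchwartzMap.tsupport_lineDerivOp_subset v a h)⟩

theorem SupportedOffZero.apply_zero {a : 𝓢(EuclideanSpace ℝ (Fin d), ℂ)}
    (ha : SupportedOffZero a) : a 0 = 0 :=
  image_eq_zero_of_notMem_tsupport ha.zero_notMem

theorem SupportedOffZero.smul_add {a b : 𝓢(EuclideanSpace ℝ (Fin d), ℂ)}
    (ha : SupportedOffZero a) (c : ℂ) (hb : SupportedOffZero b) :
    SupportedOffZero ⇑(c • a + b) := by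
  refine ⟨(ha.compact.smul_left (f := fun _ => c)).add hb.compact, ?_⟩
  rw [notMem_tsupport_iff_eventuallyEq]
  filter_upwards [notMem_tsupport_iff_eventuallyEq.1 ha.zero_notMem,
    notMem_tsupport_iff_eventuallyEq.1 hb.zero_notMem] with x hx1 hx2
  simp [hx1, hx2]

/-- The phase `e^{2πit|ξ|}` of the half-wave propagator. -/
noncomputable def wavePhase (t : ℝ) (ξ : EuclideanSpace ℝ (Fin d)) : ℂ :=
  Complex.exp (Complex.I * ((t * (2 * Real.pi * ‖ξ‖) : ℝ) : ℂ))

theorem norm_wavePhase (t : ℝ) (ξ : EuclideanSpace ℝ (Fin d)) : ‖wavePhase t ξ‖ = 1 := by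
  rw [wavePhase, mul_comm, Complex.norm_exp_ofReal_mul_I]

theorem contDiffAt_wavePhase (t : ℝ) {ξ : EuclideanSpace ℝ (Fin d)} (hξ : ξ ≠ 0) :
    ContDiffAt ℝ ∞ (wavePhase t) ξ := by
  have h1 : ContDiffAt ℝ ∞ (fun ξ : EuclideanSpace ℝ (Fin d) => t * (2 * Real.pi * ‖ξ‖)) ξ :=
    contDiffAt_const.mul (contDiffAt_const.mul (contDiffAt_norm ℝ hξ))
  exact (contDiffAt_const.mul (Complex.ofRealCLM.contDiff.contDiffAt.comp ξ h1)).cexp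

/-- The component in the direction `v` of the unit vector `ξ / |ξ|`. -/
noncomputable def dirComp (v ξ : EuclideanSpace ℝ (Fin d)) : ℂ :=
  ((inner ℝ ξ v / ‖ξ‖ : ℝ) : ℂ)

theorem contDiffAt_dirComp (v : EuclideanSpace ℝ (Fin d)) {ξ : EuclideanSpace ℝ (Fin d)}
    (hξ : ξ ≠ 0) : ContDiffAt ℝ ∞ (dirComp v) ξ := by
  have h1 : ContDiffAt ℝ ∞ (fun ξ : EuclideanSpace ℝ (Fin d) => inner ℝ ξ v / ‖ξ‖) ξ :=
    (contDiffAt_id.inner ℝ contDiffAt_const).div (contDiffAt_norm ℝ hξ) (norm_ne_zero_iff.2 hξ)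
  exact Complex.ofRealCLM.contDiff.contDiffAt.comp ξ h1

theorem hasLineDerivAt_wavePhase (t : ℝ) (v : EuclideanSpace ℝ (Fin d))
    {ξ : EuclideanSpace ℝ (Fin d)} (hξ : ξ ≠ 0) :
    HasLineDerivAt ℝ (wavePhase t) (wavePhase t ξ * (2 * Real.pi * Complex.I * t * dirComp v ξ))
      ξ v := by
  have hline : HasDerivAt (fun s : ℝ => ξ + s • v) v 0 := by
    simpa using ((hasDerivAt_id (0 : ℝ)).smul_const v).const_add ξ
  have hsq : HasDerivAt (fun s : ℝ => ‖ξ + s • v‖ ^ 2) (2 * inner ℝ ξ v) 0 := by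
    simpa using hline.norm_sq
  have hnorm : HasDerivAt (fun s : ℝ => ‖ξ + s • v‖) (inner ℝ ξ v / ‖ξ‖) 0 := by
    have h := hsq.sqrt (by simpa using hξ)
    simp only [Real.sqrt_sq (norm_nonneg _), zero_smul, add_zero] at h
    convert! h using 1
    field_simp
  have h2 : HasDerivAt (fun s : ℝ => ((t * (2 * Real.pi * ‖ξ + s • v‖) : ℝ) : ℂ))
      ((t * (2 * Real.pi * (inner ℝ ξ v / ‖ξ‖)) : ℝ) : ℂ) 0 :=
    ((hnorm.const_mul (2 * Real.pi)).const_mul t).ofReal_comp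
  have h3 := (h2.const_mul Complex.I).cexp
  rw [HasLineDerivAt]
  convert! h3 using 1
  simp only [wavePhase, dirComp, zero_smul, add_zero]
  push_cast
  ring

/-- The result is again the phase times data supported off zero, so the formula can be iterated. -/
theorem lineDerivOp_mulSchwartz_wavePhase (t : ℝ) (v : EuclideanSpace ℝ (Fin d))
    {a : 𝓢(EuclideanSpace ℝ (Fin d), ℂ)} (ha : SupportedOffZero a) :
    ∂_{v} (mulSchwartz (wavePhase t) a) = mulSchwartz (wavePhase t)
      ((2 * Real.pi * Complex.I * t : ℂ) • mulSchwartz (dirComp v) a + ∂_{v} a) := by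
  have hm : ∀ ξ : EuclideanSpace ℝ (Fin d), ξ ≠ 0 → ContDiffAt ℝ ∞ (wavePhase t) ξ :=
    fun ξ hξ => contDiffAt_wavePhase t hξ
  have hn : ∀ ξ : EuclideanSpace ℝ (Fin d), ξ ≠ 0 → ContDiffAt ℝ ∞ (dirComp v) ξ :=
    fun ξ hξ => contDiffAt_dirComp v hξ
  have hb := ha.mulSchwartz hm
  have hc := (ha.mulSchwartz hn).smul_add (2 * Real.pi * Complex.I * t) (ha.lineDerivOp v)
  ext ξ
  rw [mulSchwartz_apply hm hc]
  by_cases hξ : ξ = 0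
  · rw [hξ, (hb.lineDerivOp v).apply_zero, hc.apply_zero, mul_zero]
  · rw [SchwartzMap.lineDerivOp_apply]
    have hfun : ⇑(mulSchwartz (wavePhase t) a) = fun x => wavePhase t x * a x :=
      funext (mulSchwartz_apply hm ha)
    have hda : HasLineDerivAt ℝ a (∂_{v} a ξ) ξ v := by
      rw [SchwartzMap.lineDerivOp_apply]
      exact (a.differentiableAt.lineDifferentiableAt).hasLineDerivAt
    have h : HasLineDerivAt ℝ (fun x => wavePhase t x * a x)
        (wavePhase t ξ * (2 * Real.pi * Complex.I * t * dirComp v ξ) * a (ξ + (0 : ℝ) • v) +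
          wavePhase t (ξ + (0 : ℝ) • v) * (∂_{v} a) ξ) ξ v :=
      HasDerivAt.mul (hasLineDerivAt_wavePhase t v hξ) hda
    rw [hfun, h.lineDeriv]
    simp [mulSchwartz_apply hn ha]
    ring

end

/-! ### Second moments about the light cone -/

section

open scoped ContDiff LineDeriv

variable {d : ℕ}

theorem lineDerivOp_lineDerivOp_mulSchwartz_wavePhase (t : ℝ) (v : EuclideanSpace ℝ (Fin d))
    {a : 𝓢(EuclideanSpace ℝ (Fin d), ℂ)} (ha : SupportedOffZero a)
    (ξ : EuclideanSpace ℝ (Fin d)) :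
    (∂_{v} (∂_{v} (mulSchwartz (wavePhase t) a))) ξ = wavePhase t ξ *
      (-(4 * Real.pi ^ 2 * t ^ 2) * (dirComp v ξ ^ 2 * a ξ) + 2 * Real.pi * Complex.I * t *
        (∂_{v} (mulSchwartz (dirComp v) a) + mulSchwartz (dirComp v) (∂_{v} a)) ξ +
        (∂_{v} (∂_{v} a)) ξ) := by
  have hm : ∀ ξ : EuclideanSpace ℝ (Fin d), ξ ≠ 0 → ContDiffAt ℝ ∞ (wavePhase t) ξ :=
    fun ξ hξ => contDiffAt_wavePhase t hξ
  have hn : ∀ ξ : EuclideanSpace ℝ (Fin d), ξ ≠ 0 → ContDiffAt ℝ ∞ (dirComp v) ξ :=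
    fun ξ hξ => contDiffAt_dirComp v hξ
  have hb := (ha.mulSchwartz hn).smul_add (2 * Real.pi * Complex.I * t) (ha.lineDerivOp v)
  have hc := (hb.mulSchwartz hn).smul_add (2 * Real.pi * Complex.I * t) (hb.lineDerivOp v)
  rw [lineDerivOp_mulSchwartz_wavePhase t v ha, lineDerivOp_mulSchwartz_wavePhase t v hb,
    mulSchwartz_apply hm hc, LineDeriv.lineDerivOp_add, LineDeriv.lineDerivOp_smul]
  simp only [add_apply, smul_apply, smul_eq_mul, mulSchwartz_apply hn hb,
    mulSchwartz_apply hn ha, mulSchwartz_apply hn (ha.lineDerivOp v)]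
  linear_combination wavePhase t ξ * (4 * Real.pi ^ 2 * t ^ 2) * (dirComp v ξ ^ 2 * a ξ) *
    Complex.I_sq

/-- The eikonal identity `|∇|ξ||² = 1`, which cancels the `t²` terms in the moment bound. -/
theorem sum_dirComp_sq {ξ : EuclideanSpace ℝ (Fin d)} (hξ : ξ ≠ 0) :
    ∑ i, dirComp (EuclideanSpace.basisFun (Fin d) ℝ i) ξ ^ 2 = 1 := by
  have h : ∑ i, (ξ i) ^ 2 = ‖ξ‖ ^ 2 := (EuclideanSpace.real_norm_sq_eq ξ).symm
  have hne : ‖ξ‖ ^ 2 ≠ 0 := by simpa using hξ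
  have h2 : ∑ i, (inner ℝ ξ (EuclideanSpace.basisFun (Fin d) ℝ i) / ‖ξ‖) ^ 2 = 1 := by
    simp only [div_pow, ← Finset.sum_div]
    rw [div_eq_one_iff_eq hne, ← h]
    simp [EuclideanSpace.inner_single_right]
  simp only [dirComp]
  exact_mod_cast h2

theorem fourierInv_lineDerivOp_lineDerivOp (f : 𝓢(EuclideanSpace ℝ (Fin d), ℂ))
    (v x : EuclideanSpace ℝ (Fin d)) :
    𝓕⁻ (∂_{v} (∂_{v} f)) x = -(4 * Real.pi ^ 2) * (inner ℝ x v : ℂ) ^ 2 * 𝓕⁻ f x := by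
  have : (inner ℝ · v : EuclideanSpace ℝ (Fin d) → ℝ).HasTemperateGrowth := by fun_prop
  rw [SchwartzMap.fourierInv_lineDerivOp_eq, SchwartzMap.fourierInv_lineDerivOp_eq]
  simp [this]
  linear_combination (4 * Real.pi ^ 2) * (inner ℝ x v : ℂ) ^ 2 * 𝓕⁻ f x * Complex.I_sq

theorem integral_norm_sq_fourierInv (f : 𝓢(EuclideanSpace ℝ (Fin d), ℂ)) :
    ∫ x, ‖𝓕⁻ f x‖ ^ 2 = ∫ x, ‖f x‖ ^ 2 := by
  rw [← SchwartzMap.integral_norm_sq_fourier (𝓕⁻ f), FourierTransform.fourier_fourierInv_eq]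

theorem integrable_norm_sq_schwartz (f : 𝓢(EuclideanSpace ℝ (Fin d), ℂ)) :
    Integrable fun x => ‖f x‖ ^ 2 :=
  (f.memLp 2).integrable_norm_pow (by norm_num)

/-- The wave with frequency data `a` lives near the light cone `|x| = t`, in the sense of second
moments. -/
theorem exists_moment_bound {a : 𝓢(EuclideanSpace ℝ (Fin d), ℂ)} (ha : SupportedOffZero a) :
    ∃ D : ℝ, ∀ t : ℝ, 1 ≤ t →
      Integrable (fun x => (‖x‖ ^ 2 - t ^ 2) ^ 2 * ‖𝓕⁻ (mulSchwartz (wavePhase t) a) x‖ ^ 2) ∧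
      ∫ x, (‖x‖ ^ 2 - t ^ 2) ^ 2 * ‖𝓕⁻ (mulSchwartz (wavePhase t) a) x‖ ^ 2 ≤ D * t ^ 2 := by
  set e := EuclideanSpace.basisFun (Fin d) ℝ
  set A : 𝓢(EuclideanSpace ℝ (Fin d), ℂ) := ∑ i, (∂_{e i} (mulSchwartz (dirComp (e i)) a) +
    mulSchwartz (dirComp (e i)) (∂_{e i} a)) with hA
  set B : 𝓢(EuclideanSpace ℝ (Fin d), ℂ) := ∑ i, ∂_{e i} (∂_{e i} a) with hB
  -- `(16π⁴)⁻¹` undoes the factor `4π²` from two derivatives; the rest is `(2πt‖A‖ + ‖B‖)² ≤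
  -- 8π²t²‖A‖² + 2‖B‖²`, with `t ≥ 1` absorbing the `B` term. Neither `A` nor `B` depends on `t`.
  refine ⟨(16 * Real.pi ^ 4)⁻¹ * (8 * Real.pi ^ 2 * ∫ x, ‖A x‖ ^ 2) +
    (16 * Real.pi ^ 4)⁻¹ * (2 * ∫ x, ‖B x‖ ^ 2), fun t ht => ?_⟩
  have hm : ∀ ξ : EuclideanSpace ℝ (Fin d), ξ ≠ 0 → ContDiffAt ℝ ∞ (wavePhase t) ξ :=
    fun ξ hξ => contDiffAt_wavePhase t hξ
  set w := mulSchwartz (wavePhase t) a with hw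
  set G : 𝓢(EuclideanSpace ℝ (Fin d), ℂ) :=
    (4 * Real.pi ^ 2 * t ^ 2 : ℂ) • w + ∑ i, ∂_{e i} (∂_{e i} w) with hG
  -- The quadratic terms in `t` cancel here, leaving growth of first order.
  have hGA : ∀ ξ, G ξ = wavePhase t ξ * (2 * Real.pi * Complex.I * t * A ξ + B ξ) := by
    intro ξ
    have hsum : (∑ i, dirComp (e i) ξ ^ 2) * a ξ = a ξ := by
      by_cases hξ : ξ = 0
      · rw [hξ, ha.apply_zero, mul_zero]
      · rw [sum_dirComp_sq hξ, one_mul]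
    simp only [hG, hA, hB, add_apply, smul_apply, sum_apply, smul_eq_mul, hw,
      mulSchwartz_apply hm ha, lineDerivOp_lineDerivOp_mulSchwartz_wavePhase t _ ha]
    rw [← Finset.mul_sum, Finset.sum_add_distrib, Finset.sum_add_distrib, ← Finset.mul_sum,
      ← Finset.mul_sum, ← Finset.sum_mul, hsum]
    ring
  have hFG : ∀ x, 𝓕⁻ G x = -(4 * Real.pi ^ 2) * ((‖x‖ ^ 2 - t ^ 2 : ℝ) : ℂ) * 𝓕⁻ w x := by
    intro x
    have hx : ∑ i, (inner ℝ x (e i) : ℂ) ^ 2 = ((‖x‖ ^ 2 : ℝ) : ℂ) := by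
      rw [EuclideanSpace.real_norm_sq_eq]
      simp [e, EuclideanSpace.inner_single_right]
    have hlin : 𝓕⁻ G = (4 * Real.pi ^ 2 * t ^ 2 : ℂ) • 𝓕⁻ w +
        ∑ i, 𝓕⁻ (∂_{e i} (∂_{e i} w)) := by
      rw [hG]
      exact (map_add (FourierTransform.fourierInvCLM ℂ 𝓢(EuclideanSpace ℝ (Fin d), ℂ)) _ _).trans
        (by rw [map_smul, map_sum]; rfl)
    rw [hlin]
    simp only [add_apply, smul_apply, sum_apply, smul_eq_mul,
      fourierInv_lineDerivOp_lineDerivOp]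
    rw [← Finset.sum_mul, ← Finset.mul_sum, hx]
    push_cast
    ring
  have hpt : ∀ x, (‖x‖ ^ 2 - t ^ 2) ^ 2 * ‖𝓕⁻ w x‖ ^ 2 =
      (16 * Real.pi ^ 4)⁻¹ * ‖𝓕⁻ G x‖ ^ 2 := by
    intro x
    rw [hFG, norm_mul, norm_mul, mul_pow, mul_pow, Complex.norm_real, Real.norm_eq_abs, sq_abs]
    have : ‖(-(4 * Real.pi ^ 2) : ℂ)‖ = 4 * Real.pi ^ 2 := by
      simp [abs_of_pos Real.pi_pos]
    rw [this]
    field_simp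
    ring
  simp only [hpt]
  refine ⟨(integrable_norm_sq_schwartz (𝓕⁻ G)).const_mul _, ?_⟩
  rw [integral_const_mul, integral_norm_sq_fourierInv]
  have hbound : ∫ ξ, ‖G ξ‖ ^ 2 ≤
      (8 * Real.pi ^ 2 * t ^ 2) * (∫ x, ‖A x‖ ^ 2) + 2 * ∫ x, ‖B x‖ ^ 2 := by
    rw [← integral_const_mul, ← integral_const_mul, ← integral_add
      ((integrable_norm_sq_schwartz A).const_mul _) ((integrable_norm_sq_schwartz B).const_mul _)]
    refine integral_mono (integrable_norm_sq_schwartz G)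
      (((integrable_norm_sq_schwartz A).const_mul _).add
        ((integrable_norm_sq_schwartz B).const_mul _)) fun ξ => ?_
    have h1 : ‖G ξ‖ ≤ 2 * Real.pi * t * ‖A ξ‖ + ‖B ξ‖ := by
      rw [hGA, norm_mul, norm_wavePhase, one_mul]
      refine (norm_add_le _ _).trans (le_of_eq ?_)
      simp [abs_of_pos Real.pi_pos, abs_of_pos (one_pos.trans_le ht)]
    have h2 := pow_le_pow_left₀ (norm_nonneg _) h1 2
    simp only
    nlinarith [sq_nonneg (2 * Real.pi * t * ‖A ξ‖ - ‖B ξ‖)]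
  have hB0 : (0 : ℝ) ≤ ∫ x, ‖B x‖ ^ 2 := integral_nonneg fun _ => by positivity
  have ht2 : 1 ≤ t ^ 2 := one_le_pow₀ ht
  calc (16 * Real.pi ^ 4)⁻¹ * ∫ ξ, ‖G ξ‖ ^ 2 ≤ (16 * Real.pi ^ 4)⁻¹ *
        ((8 * Real.pi ^ 2 * t ^ 2) * (∫ x, ‖A x‖ ^ 2) + 2 * ((∫ x, ‖B x‖ ^ 2) * t ^ 2)) := by
        refine mul_le_mul_of_nonneg_left (hbound.trans ?_) (by positivity)
        nlinarith
    _ = _ := by ring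

end

/-! ### Mass in a spherical shell and lower bounds for the `L^r` norm -/

section

variable {d : ℕ}

theorem pow_succ_sub_pow_succ_le {x y : ℝ} (hy : 0 ≤ y) (hyx : y ≤ x) (n : ℕ) :
    x ^ (n + 1) - y ^ (n + 1) ≤ (n + 1) * (x - y) * x ^ n := by
  induction n with
  | zero => simp
  | succ n ih =>
    have hx : 0 ≤ x := hy.trans hyx
    have h1 := mul_le_mul_of_nonneg_left ih hx
    have h2 : (x - y) * y ^ (n + 1) ≤ (x - y) * x ^ (n + 1) :=
      mul_le_mul_of_nonneg_left (pow_le_pow_left₀ hy hyx _) (sub_nonneg.2 hyx)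
    push_cast
    calc x ^ (n + 1 + 1) - y ^ (n + 1 + 1)
        = x * (x ^ (n + 1) - y ^ (n + 1)) + (x - y) * y ^ (n + 1) := by ring
      _ ≤ x * ((n + 1) * (x - y) * x ^ n) + (x - y) * x ^ (n + 1) := add_le_add h1 h2
      _ = _ := by ring

/-- The spherical shell of radius `t` and half-width `R`. -/
def shell (d : ℕ) (t R : ℝ) : Set (EuclideanSpace ℝ (Fin d)) := {x | |‖x‖ - t| ≤ R}

theorem measurableSet_shell (t R : ℝ) : MeasurableSet (shell d t R) :=
  measurableSet_le (by fun_prop) measurable_const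

theorem exists_volume_shell_le (hd : 0 < d) {R : ℝ} (hR : 0 < R) :
    ∃ K : ℝ, 0 < K ∧ ∀ t : ℝ, R ≤ t →
      volume (shell d t R) ≤ ENNReal.ofReal (K * t ^ ((d : ℝ) - 1)) := by
  obtain ⟨n, rfl⟩ : ∃ n, d = n + 1 := ⟨d - 1, by omega⟩
  set V := (volume (Metric.ball (0 : EuclideanSpace ℝ (Fin (n + 1))) 1)).toReal with hV
  have hVfin : volume (Metric.ball (0 : EuclideanSpace ℝ (Fin (n + 1))) 1) ≠ ∞ :=
    measure_ball_lt_top.ne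
  have hV0 : 0 < V := ENNReal.toReal_pos (Metric.measure_ball_pos _ _ one_pos).ne' hVfin
  refine ⟨(n + 1) * (2 * R) * 2 ^ n * V, by positivity, fun t ht => ?_⟩
  have ht0 : 0 < t := hR.trans_le ht
  have hsub : shell (n + 1) t R ⊆ Metric.closedBall 0 (t + R) \ Metric.ball 0 (t - R) := by
    intro x hx
    have := abs_le.1 (show |‖x‖ - t| ≤ R from hx)
    simp only [mem_sdiff, Metric.mem_closedBall, Metric.mem_ball, dist_zero_right, not_lt]
    constructor <;> linarith
  refine (measure_mono hsub).trans ?_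
  rw [measure_sdiff ((Metric.ball_subset_ball (by linarith)).trans Metric.ball_subset_closedBall)
    measurableSet_ball.nullMeasurableSet measure_ball_lt_top.ne,
    Measure.addHaar_closedBall volume 0 (by linarith : 0 ≤ t + R),
    Measure.addHaar_ball volume 0 (by linarith : 0 ≤ t - R),
    ← ENNReal.ofReal_toReal hVfin, ← hV, ← ENNReal.ofReal_mul (by positivity),
    ← ENNReal.ofReal_mul (pow_nonneg (by linarith) _),
    ← ENNReal.ofReal_sub _ (mul_nonneg (pow_nonneg (by linarith) _) hV0.le)]
  refine ENNReal.ofReal_le_ofReal ?_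
  have hexp : t ^ (((n + 1 : ℕ) : ℝ) - 1) = t ^ n := by
    rw [Nat.cast_add, Nat.cast_one, add_sub_cancel_right, Real.rpow_natCast]
  rw [hexp, ← sub_mul, finrank_euclideanSpace_fin]
  have h1 := pow_succ_sub_pow_succ_le (x := t + R) (y := t - R) (by linarith) (by linarith) n
  have h2 : (t + R) ^ n ≤ (2 * t) ^ n := pow_le_pow_left₀ (by linarith) (by linarith) n
  calc ((t + R) ^ (n + 1) - (t - R) ^ (n + 1)) * V
      ≤ ((n + 1) * (t + R - (t - R)) * (t + R) ^ n) * V := by gcongr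
    _ = ((n + 1) * (2 * R) * (t + R) ^ n) * V := by ring
    _ ≤ ((n + 1) * (2 * R) * (2 * t) ^ n) * V := by gcongr
    _ = _ := by rw [mul_pow]; ring

/-- Chebyshev: off the shell `||x|² - t²| = ||x| - t| (|x| + t) ≥ Rt`, so the mass there is at most
`D / R² ≤ M / 2`. -/
theorem half_mass_le_integral_shell {u : 𝓢(EuclideanSpace ℝ (Fin d), ℂ)} {M D R t : ℝ}
    (hM : ∫ x, ‖u x‖ ^ 2 = M) (hR : 0 < R) (hDR : 2 * D ≤ M * R ^ 2) (ht : 1 ≤ t)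
    (hint : Integrable (fun x => (‖x‖ ^ 2 - t ^ 2) ^ 2 * ‖u x‖ ^ 2))
    (hD : ∫ x, (‖x‖ ^ 2 - t ^ 2) ^ 2 * ‖u x‖ ^ 2 ≤ D * t ^ 2) :
    M / 2 ≤ ∫ x in shell d t R, ‖u x‖ ^ 2 := by
  have ht0 : 0 < t := one_pos.trans_le ht
  have hu := integrable_norm_sq_schwartz u
  have hsplit := integral_add_compl (measurableSet_shell t R) hu
  have hout : ∫ x in (shell d t R)ᶜ, ‖u x‖ ^ 2 ≤ M / 2 := by
    have h1 : ∫ x in (shell d t R)ᶜ, ‖u x‖ ^ 2 ≤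
        ∫ x in (shell d t R)ᶜ, (R ^ 2 * t ^ 2)⁻¹ * ((‖x‖ ^ 2 - t ^ 2) ^ 2 * ‖u x‖ ^ 2) := by
      refine setIntegral_mono_on hu.integrableOn (hint.const_mul _).integrableOn
        (measurableSet_shell t R).compl fun x hx => ?_
      have hx' : R < |‖x‖ - t| := not_le.1 hx
      have h2 : R ^ 2 ≤ (‖x‖ - t) ^ 2 := by
        rw [← sq_abs (‖x‖ - t)]
        exact pow_le_pow_left₀ hR.le hx'.le 2
      have h3 : t ^ 2 ≤ (‖x‖ + t) ^ 2 :=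
        pow_le_pow_left₀ ht0.le (le_add_of_nonneg_left (norm_nonneg x)) 2
      have h4 : R ^ 2 * t ^ 2 ≤ (‖x‖ ^ 2 - t ^ 2) ^ 2 := by
        calc R ^ 2 * t ^ 2 ≤ (‖x‖ - t) ^ 2 * (‖x‖ + t) ^ 2 := by gcongr
          _ = _ := by ring
      rw [← mul_assoc]
      refine le_mul_of_one_le_left (by positivity) ?_
      rwa [inv_mul_eq_div, one_le_div (by positivity)]
    have h5 := setIntegral_le_integral (s := (shell d t R)ᶜ)
      (hint.const_mul ((R ^ 2 * t ^ 2)⁻¹)) (Filter.Eventually.of_forall fun x => by positivity)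
    refine h1.trans (h5.trans ?_)
    rw [integral_const_mul, inv_mul_eq_div, div_le_iff₀ (by positivity)]
    nlinarith [sq_nonneg t]
  linarith

/-- Hölder on the shell compares the `L²` norm, at least `√(M/2)`, with the `L^r` norm at the cost
of the volume to the power `1/2 - 1/r`. -/
theorem exists_eLpNorm_ge_of_moment_bound (hd : 0 < d)
    {u : ℝ → 𝓢(EuclideanSpace ℝ (Fin d), ℂ)} {M D : ℝ} (hM0 : 0 < M)
    (hM : ∀ t, ∫ x, ‖u t x‖ ^ 2 = M)
    (hD : ∀ t, 1 ≤ t → Integrable (fun x => (‖x‖ ^ 2 - t ^ 2) ^ 2 * ‖u t x‖ ^ 2) ∧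
      ∫ x, (‖x‖ ^ 2 - t ^ 2) ^ 2 * ‖u t x‖ ^ 2 ≤ D * t ^ 2)
    {r : ℝ≥0∞} (hr : 2 ≤ r) :
    ∃ c T : ℝ, 0 < c ∧ 1 ≤ T ∧ ∀ t, T ≤ t →
      ENNReal.ofReal (c * t ^ (-(((d : ℝ) - 1) * (1 / 2 - (1 / r).toReal)))) ≤
        eLpNorm (u t) r volume := by
  obtain ⟨R, hR, hDR⟩ : ∃ R : ℝ, 0 < R ∧ 2 * D ≤ M * R ^ 2 := by
    -- With `y = 2|D|/M` this is `y ≤ (1 + y)²`.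
    refine ⟨1 + 2 * |D| / M, by positivity, ?_⟩
    have h1 : 2 * |D| / M ≤ (1 + 2 * |D| / M) ^ 2 := by
      nlinarith [show 0 ≤ 2 * |D| / M by positivity]
    have h2 := mul_le_mul_of_nonneg_left h1 hM0.le
    rw [mul_div_cancel₀ _ hM0.ne'] at h2
    linarith [le_abs_self D]
  obtain ⟨K, hK, hvol⟩ := exists_volume_shell_le hd hR
  set θ : ℝ := 1 / 2 - (1 / r).toReal with hθ
  have hθ0 : 0 ≤ θ := by
    have : (1 / r).toReal ≤ (1 / 2 : ℝ≥0∞).toReal :=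
      ENNReal.toReal_mono (by simp) (ENNReal.div_le_div_left hr 1)
    rw [ENNReal.toReal_div 1 2] at this
    simp only [ENNReal.toReal_one, ENNReal.toReal_ofNat] at this
    linarith
  refine ⟨√(M / 2) / K ^ θ, max 1 R, by positivity, le_max_left _ _, fun t ht => ?_⟩
  have ht1 : 1 ≤ t := (le_max_left _ _).trans ht
  have ht0 : 0 < t := one_pos.trans_le ht1
  have hmass := half_mass_le_integral_shell (hM t) hR hDR ht1 (hD t ht1).1 (hD t ht1).2
  have hL2 : ENNReal.ofReal √(M / 2) ≤ eLpNorm (u t) 2 (volume.restrict (shell d t R)) := by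
    have hmem : MemLp (u t) 2 (volume.restrict (shell d t R)) := ((u t).memLp 2).restrict _
    rw [hmem.eLpNorm_eq_integral_rpow_norm (by norm_num) (by norm_num)]
    refine ENNReal.ofReal_le_ofReal ?_
    rw [Real.sqrt_eq_rpow]
    simpa using Real.rpow_le_rpow (by positivity) hmass (by norm_num : (0 : ℝ) ≤ 1 / 2)
  have hholder := eLpNorm_le_eLpNorm_mul_rpow_measure_univ hr
    ((u t).continuous.aestronglyMeasurable (μ := volume.restrict (shell d t R)))
  have hexp : 1 / (2 : ℝ≥0∞).toReal - 1 / r.toReal = θ := by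
    rw [hθ, ENNReal.toReal_div]
    simp
  rw [hexp, Measure.restrict_apply_univ] at hholder
  have hvolθ : volume (shell d t R) ^ θ ≤ ENNReal.ofReal (K ^ θ * t ^ (((d : ℝ) - 1) * θ)) := by
    refine (ENNReal.rpow_le_rpow (hvol t ((le_max_right _ _).trans ht)) hθ0).trans (le_of_eq ?_)
    rw [ENNReal.ofReal_rpow_of_nonneg (by positivity) hθ0,
      Real.mul_rpow hK.le (by positivity), ← Real.rpow_mul ht0.le]
  have hpos : 0 < K ^ θ * t ^ (((d : ℝ) - 1) * θ) := by positivity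
  have hfinal : ENNReal.ofReal (√(M / 2) / K ^ θ * t ^ (-(((d : ℝ) - 1) * θ))) *
      ENNReal.ofReal (K ^ θ * t ^ (((d : ℝ) - 1) * θ)) ≤
      eLpNorm (u t) r volume * ENNReal.ofReal (K ^ θ * t ^ (((d : ℝ) - 1) * θ)) := by
    rw [← ENNReal.ofReal_mul (by positivity)]
    have : √(M / 2) / K ^ θ * t ^ (-(((d : ℝ) - 1) * θ)) * (K ^ θ * t ^ (((d : ℝ) - 1) * θ)) =
        √(M / 2) := by
      rw [Real.rpow_neg ht0.le]
      have h1 := (Real.rpow_pos_of_pos hK θ).ne'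
      have h2 := (Real.rpow_pos_of_pos ht0 (((d : ℝ) - 1) * θ)).ne'
      field_simp
    rw [this]
    exact hL2.trans (hholder.trans (mul_le_mul' (eLpNorm_mono_measure _ Measure.restrict_le_self)
      hvolθ))
  exact (ENNReal.mul_le_mul_iff_left (by simpa using hpos) ENNReal.ofReal_ne_top).1 hfinal

end

/-! ### The test input and its Duhamel integral -/

section

open scoped ContDiff

variable {d : ℕ}

theorem fourier_const_mul_fourierInv (c : ℂ) (χ : 𝓢(EuclideanSpace ℝ (Fin d), ℂ)) :
    𝓕 (fun y => c * 𝓕⁻ χ y) = fun ξ => c * χ ξ := by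
  have h1 : (fun y => c * 𝓕⁻ χ y) = ⇑(c • 𝓕⁻ χ) := by
    ext y
    simp
  rw [h1, ← SchwartzMap.fourier_coe, FourierTransform.fourier_smul,
    FourierTransform.fourier_fourierInv_eq]
  ext ξ
  simp

theorem continuous_wavePhase :
    Continuous fun z : ℝ × EuclideanSpace ℝ (Fin d) => wavePhase z.1 z.2 := by
  unfold wavePhase
  fun_prop

theorem wavePhase_sub (t s : ℝ) (ξ : EuclideanSpace ℝ (Fin d)) :
    wavePhase (t - s) ξ = wavePhase t ξ * wavePhase (-s) ξ := by
  rw [wavePhase, wavePhase, wavePhase, ← Complex.exp_add]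
  congr 1
  push_cast
  ring

/-- As a function of time the phase is the Fourier character of frequency `|ξ|`. -/
theorem integral_wavePhase_neg_mul (ψ : 𝓢(ℝ, ℂ)) (ξ : EuclideanSpace ℝ (Fin d)) :
    ∫ s, wavePhase (-s) ξ * ψ s = 𝓕 ψ ‖ξ‖ := by
  rw [SchwartzMap.fourier_coe, Real.fourier_real_eq_integral_exp_smul]
  refine integral_congr_ae (Filter.Eventually.of_forall fun s => ?_)
  simp only [wavePhase, smul_eq_mul]
  congr 2
  push_cast
  ring

/-- The operator `waveDuhamel` maps `ψ ⊗ 𝓕⁻ χ` to the free wave with frequency data `χ`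
when the time frequency `𝓕 ψ` equals one on the range of `|ξ|` over the support of `χ`. -/
theorem waveDuhamel_tensorMul {ψ : 𝓢(ℝ, ℂ)} {χ : 𝓢(EuclideanSpace ℝ (Fin d), ℂ)}
    (hχ : SupportedOffZero χ) (h : ∀ ξ, 𝓕 ψ ‖ξ‖ * χ ξ = χ ξ) (t : ℝ)
    (x : EuclideanSpace ℝ (Fin d)) :
    waveDuhamel (ψ.tensorMul (𝓕⁻ χ)) t x = 𝓕⁻ (mulSchwartz (wavePhase t) χ) x := by
  have hm : ∀ ξ : EuclideanSpace ℝ (Fin d), ξ ≠ 0 → ContDiffAt ℝ ∞ (wavePhase t) ξ :=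
    fun ξ hξ => contDiffAt_wavePhase t hξ
  set k : EuclideanSpace ℝ (Fin d) → ℂ :=
    fun ξ => Complex.exp (((2 * Real.pi * inner ℝ ξ x : ℝ) : ℂ) * Complex.I) with hk
  have hknorm : ∀ ξ, ‖k ξ‖ = 1 := fun ξ => Complex.norm_exp_ofReal_mul_I _
  have hkcont : Continuous k := by
    rw [hk]
    fun_prop
  have h1 : waveDuhamel (ψ.tensorMul (𝓕⁻ χ)) t x =
      ∫ s, ∫ ξ, k ξ * (wavePhase (t - s) ξ * (ψ s * χ ξ)) := by
    unfold waveDuhamel halfWave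
    refine integral_congr_ae (Filter.Eventually.of_forall fun s => ?_)
    simp only [SchwartzMap.tensorMul_apply]
    rw [fourier_const_mul_fourierInv, Real.fourierInv_eq']
    rfl
  have hcont : Continuous fun z : ℝ × EuclideanSpace ℝ (Fin d) =>
      k z.2 * (wavePhase (t - z.1) z.2 * (ψ z.1 * χ z.2)) := by
    have := continuous_wavePhase.comp (((continuous_const (y := t)).sub continuous_fst).prodMk
      (continuous_snd (X := ℝ) (Y := EuclideanSpace ℝ (Fin d))))
    exact (hkcont.comp continuous_snd).mul (this.mul
      ((ψ.continuous.comp continuous_fst).mul (χ.continuous.comp continuous_snd)))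
  have hint : Integrable (Function.uncurry fun (s : ℝ) (ξ : EuclideanSpace ℝ (Fin d)) =>
      k ξ * (wavePhase (t - s) ξ * (ψ s * χ ξ))) (volume.prod volume) := by
    refine ((ψ.integrable (μ := volume)).mul_prod (χ.integrable (μ := volume))).mono
      hcont.aestronglyMeasurable (Filter.Eventually.of_forall fun z => ?_)
    simp [Function.uncurry, hknorm, norm_wavePhase]
  rw [h1, integral_integral_swap hint, SchwartzMap.fourierInv_coe, Real.fourierInv_eq']
  refine integral_congr_ae (Filter.Eventually.of_forall fun ξ => ?_)
  have h2 : ∀ s, k ξ * (wavePhase (t - s) ξ * (ψ s * χ ξ)) =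
      k ξ * wavePhase t ξ * χ ξ * (wavePhase (-s) ξ * ψ s) := by
    intro s
    rw [wavePhase_sub]
    ring
  simp only [h2]
  rw [integral_const_mul, integral_wavePhase_neg_mul, mulSchwartz_apply hm hχ, smul_eq_mul]
  linear_combination k ξ * wavePhase t ξ * h ξ

theorem mixedNorm_tensorMul_lt_top (ψ : 𝓢(ℝ, ℂ)) (f : 𝓢(EuclideanSpace ℝ (Fin d), ℂ))
    (q r : ℝ≥0∞) : mixedNorm (fun t x => ψ.tensorMul f (t, x)) q r < ⊤ := by
  have hN : eLpNorm f r volume ≠ ⊤ := (f.memLp r volume).eLpNorm_ne_top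
  have h1 : ∀ t, eLpNorm (fun x => ψ.tensorMul f (t, x)) r volume =
      ‖(eLpNorm f r volume).toReal • ψ t‖ₑ := by
    intro t
    have := eLpNorm_const_smul (ψ t) f r volume
    rw [enorm_smul, mul_comm, Real.enorm_of_nonneg ENNReal.toReal_nonneg, ENNReal.ofReal_toReal hN]
    exact this
  unfold mixedNorm
  simp only [h1]
  rw [eLpNorm_enorm]
  exact ((ψ.memLp q volume).const_smul (eLpNorm f r volume).toReal).eLpNorm_lt_top

/-- `χ` is a bump of radius `1/2` about a unit vector `e`. Since `||ξ| - 1| ≤ |ξ - e|`, a bump equal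
to one within `1/2` of `1` serves as `𝓕 ψ`. -/
theorem exists_frequency_data (hd : 0 < d) :
    ∃ (ψ : 𝓢(ℝ, ℂ)) (χ : 𝓢(EuclideanSpace ℝ (Fin d), ℂ)), SupportedOffZero χ ∧
      (∀ ξ, 𝓕 ψ ‖ξ‖ * χ ξ = χ ξ) ∧ 0 < ∫ ξ, ‖χ ξ‖ ^ 2 := by
  set e : EuclideanSpace ℝ (Fin d) := EuclideanSpace.single ⟨0, hd⟩ 1
  have he : ‖e‖ = 1 := by simp [e]
  let b : ContDiffBump e := ⟨1 / 4, 1 / 2, by norm_num, by norm_num⟩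
  let φ : ContDiffBump (1 : ℝ) := ⟨1 / 2, 1, by norm_num, by norm_num⟩
  have hbs : HasCompactSupport fun ξ => (b ξ : ℂ) :=
    b.hasCompactSupport.comp_left (g := ((↑) : ℝ → ℂ)) Complex.ofReal_zero
  have hφs : HasCompactSupport fun ρ => (φ ρ : ℂ) :=
    φ.hasCompactSupport.comp_left (g := ((↑) : ℝ → ℂ)) Complex.ofReal_zero
  have hbc : ContDiff ℝ ∞ fun ξ => (b ξ : ℂ) := Complex.ofRealCLM.contDiff.comp b.contDiff
  have hφc : ContDiff ℝ ∞ fun ρ => (φ ρ : ℂ) := Complex.ofRealCLM.contDiff.comp φ.contDiff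
  refine ⟨𝓕⁻ (hφs.toSchwartzMap hφc), hbs.toSchwartzMap hbc, ⟨hbs, ?_⟩, fun ξ => ?_, ?_⟩
  · have hsub : tsupport (fun ξ => (b ξ : ℂ)) ⊆ tsupport b :=
      closure_mono fun ξ hξ hb => hξ (by simp [hb])
    intro h0
    have := hsub h0
    rw [b.tsupport_eq, Metric.mem_closedBall, dist_zero_left, he] at this
    norm_num [b] at this
  · rw [FourierTransform.fourier_fourierInv_eq]
    change (φ ‖ξ‖ : ℂ) * (b ξ : ℂ) = (b ξ : ℂ)
    by_cases hξ : ξ ∈ Metric.ball e (1 / 2)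
    · have : φ ‖ξ‖ = 1 := by
        refine φ.one_of_mem_closedBall ?_
        have := (abs_norm_sub_norm_le ξ e).trans (mem_ball_iff_norm.1 hξ).le
        rwa [he] at this
      rw [this, Complex.ofReal_one, one_mul]
    · have : b ξ = 0 := b.zero_of_le_dist (not_lt.1 hξ)
      rw [this, Complex.ofReal_zero, mul_zero]
  · refine Continuous.integral_pos_of_hasCompactSupport_nonneg_nonzero (x := e)
      (f := fun ξ => ‖(b ξ : ℂ)‖ ^ 2) (hbc.continuous.norm.pow 2)
      (hbs.comp_left (g := fun z : ℂ => ‖z‖ ^ 2) (by simp)) (fun _ => by positivity) ?_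
    have : b e = 1 := b.one_of_mem_closedBall (Metric.mem_closedBall_self (by norm_num [b]))
    simp [this]

end

/-! ### The necessary condition -/

theorem proposition3p1 (d : ℕ) (hd : 2 ≤ d) (q p : ℝ) (qt r rt : ℝ≥0∞)
    (hq : 1 ≤ q) (hp : 1 ≤ p) (hqt1 : 1 ≤ qt) (hqt : qt < ∞) (hr : 2 ≤ r) (hrt : 2 ≤ rt)
    (hest : ∀ K : Set (EuclideanSpace ℝ (Fin d)), IsCompact K → 0 ∉ K →
      ∃ C : ℝ≥0, ∀ F : 𝓢(ℝ × EuclideanSpace ℝ (Fin d), ℂ), SpatialFourierSupportIn F K →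
        lorentzMixedNorm (waveDuhamel F) q p r ≤
          C * mixedNorm (fun t x => F (t, x)) qt.conjExponent rt.conjExponent) :
    1 / q < ((d : ℝ) - 1) * (1 / 2 - (1 / r).toReal) := by
  by_contra! hle
  obtain ⟨ψ, χ, hχ, hψχ, hM⟩ := exists_frequency_data (d := d) (by omega)
  obtain ⟨C, hC⟩ := hest (tsupport χ) hχ.compact hχ.zero_notMem
  have hF := hC (ψ.tensorMul (𝓕⁻ χ)) fun t => by
    simp only [SchwartzMap.tensorMul_apply]
    rw [fourier_const_mul_fourierInv]
    exact tsupport_mul_subset_right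
  obtain ⟨D, hD⟩ := exists_moment_bound hχ
  have hmass : ∀ t, ∫ x, ‖𝓕⁻ (mulSchwartz (wavePhase t) χ) x‖ ^ 2 = ∫ ξ, ‖χ ξ‖ ^ 2 := by
    intro t
    rw [integral_norm_sq_fourierInv]
    refine integral_congr_ae (Filter.Eventually.of_forall fun ξ => ?_)
    simp only [mulSchwartz_apply (fun ξ hξ => contDiffAt_wavePhase t hξ) hχ, norm_mul,
      norm_wavePhase, one_mul]
  obtain ⟨c, T, hc, hT, hlow⟩ := exists_eLpNorm_ge_of_moment_bound (by omega)
    (u := fun t => 𝓕⁻ (mulSchwartz (wavePhase t) χ)) hM hmass hD hr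
  have htop : lorentzMixedNorm (waveDuhamel (ψ.tensorMul (𝓕⁻ χ))) q p r = ∞ := by
    refine lorentzNorm_eq_top_of_rpow_le (by linarith) (by linarith) hc (one_pos.trans_le hT)
      fun t ht => ?_
    rw [funext (waveDuhamel_tensorMul hχ hψχ t)]
    -- For `t ≥ 1` the negated conclusion `hle` orders the two powers of `t`.
    refine le_trans (ENNReal.ofReal_le_ofReal ?_) (hlow t ht)
    gcongr
    exact hT.trans ht
  rw [htop, top_le_iff] at hF
  exact ENNReal.mul_ne_top ENNReal.coe_ne_top (mixedNorm_tensorMul_lt_top _ _ _ _).ne hF
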